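/- **Theorem (Lower bound).** There are universal constants $c_0,c_1,c_2>0$ such that the following holds. Let $d\ge 2$, $n\ge 2$, $0<\Delta\le 1$ and $\zeta\ge 3\Delta\sqrt{8\log n/(d-1)}$. Then there are a decision set $\mathcal D\subset\mathbb R^d$ of $|\mathcal D|=n$ unit vectors and a nonempty finite set $\Theta$ of stochastic linear bandit instances with arm set $\mathcal D$. An instance $\nu\in\Theta$ consists of a vector $\theta_\nu\in\mathbb R^d$ and of expected rewards $r_\nu:\mathcal D\to\mathbb R$, and pulling $x\in\mathcal D$ yields a reward with law $\mathcal N(r_\nu(x),1)$, independent of the past. Every $\nu\in\Theta$ satisfies $\|\theta_\nu\|_2\le 3\Delta$, $0\le r_\nu\le 2\Delta$ (so that $0\le r_\nu\le 1$ if $\Delta\le 1/2$), has minimal sub-optimality gap exactly $\Delta$, i.e. $\min\{r_\nu^*-r_\nu(x): x\in\mathcal D,\ r_\nu(x)<r_\nu^*\}=\Delta$ with $r_\nu^*=\max_{x\in\mathcal D} r_\nu(x)$, and has misspecification level $\zeta$, i.e. $|r_\nu(x)-x^\top\theta_\nu|\le\zeta$ for all $x\in\mathcal D$. Let an algorithm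 be any (possibly randomized) rule that selects the arm $x_k$ of round $k$ from the arms and rewards of the previous rounds, and let $\mathrm{Regret}_\nu(K)=\sum_{k=1}^K (r_\nu^*-r_\nu(x_k))$. For every algorithm, every $K\ge 1$, $C>0$ and $0\le\alpha<1$ such that $\mathbb E[\mathrm{Regret}_\nu(K)]\le CK^\alpha$ for all $\nu\in\Theta$: 1. if $K\le c_0\,n$, then $\displaystyle\frac1{|\Theta|}\sum_{\nu\in\Theta}\mathbb E[\mathrm{Regret}_\nu(K)]\ge K\Delta$; 2. if $K\ge c_1\, n/\Delta^2$, then $\displaystyle\sup_{\nu\in\Theta}\mathbb E[\mathrm{Regret}_\nu(K)]\ge c_2\,\frac{n\log K}{\Delta\,\log(n/\Delta)}$; moreover, for every $K\ge 1$ as above, $\displaystyle\sup_{\nu\in\Theta}\mathbb E[\mathrm{Regret}_\nu(K)]\ge c_2\,\frac n\Delta\,\max\Big\{(1-\alpha)\log K-\log\frac{8C}{\Delta},\,0\Big\}$. -/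

import Mathlib

open MeasureTheory ProbabilityTheory

noncomputable section

/-- A stochastic linear bandit instance with `n` arms in dimension `d`: the parameter vector of the
approximating linear function, and the expected reward of every arm. Pulling arm `a` produces a
reward with law `N(mean a, 1)`, see `BanditInstance.rewardKernel`. -/
@[ext]
structure BanditInstance (d n : ℕ) where
  param : EuclideanSpace ℝ (Fin d)
  mean : Fin n → ℝ

namespace BanditInstance

variable {d n : ℕ}

/-- The optimal expected reward. -/
def optReward (ν : BanditInstance d n) : ℝ := ⨆ a, ν.mean a

/-- The sub-optimality gap of arm `a`. -/
def gap (ν : BanditInstance d n) (a : Fin n) : ℝ := ν.optReward - ν.mean a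

/-- `Δ` is the minimum of the positive sub-optimality gaps (in particular this set of gaps is not
empty). -/
def HasMinGap (ν : BanditInstance d n) (Δ : ℝ) : Prop :=
  IsLeast {δ : ℝ | 0 < δ ∧ ∃ a, ν.gap a = δ} Δ

/-- On the decision set `{x a}`, the expected reward differs from the linear function
`y ↦ ⟪y, param⟫` by at most `ζ`. -/
def IsMisspecified (ν : BanditInstance d n) (x : Fin n → EuclideanSpace ℝ (Fin d)) (ζ : ℝ) : Prop :=
  ∀ a, |ν.mean a - inner ℝ (x a) ν.param| ≤ ζ

/-- The law of the observed reward given the pulled arm: a Gaussian with unit variance. -/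
def rewardKernel (ν : BanditInstance d n) : Kernel (Fin n) ℝ :=
  Kernel.ofFunOfCountable fun a => gaussianReal (ν.mean a) 1

instance (ν : BanditInstance d n) : IsMarkovKernel ν.rewardKernel :=
  ⟨fun a => inferInstanceAs (IsProbabilityMeasure (gaussianReal (ν.mean a) 1))⟩

end BanditInstance

/-- The history of the first `k` rounds: the pulled arms and the observed rewards. -/
abbrev History (n k : ℕ) : Type := Fin k → Fin n × ℝ

/-- A (possibly randomized) bandit algorithm: for every round, a probability distribution over the
arms that depends measurably on the history of the previous rounds. -/
structure BanditAlgorithm (n : ℕ) where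
  select : (k : ℕ) → Kernel (History n k) (Fin n)
  markov : ∀ k, IsMarkovKernel (select k)

namespace BanditAlgorithm

variable {d n : ℕ}

instance (π : BanditAlgorithm n) (k : ℕ) : IsMarkovKernel (π.select k) := π.markov k

/-- The law of the next pair (arm, reward) given the history: the algorithm selects the arm, then
the reward is drawn from the law of that arm, independently of the past. -/
def step (π : BanditAlgorithm n) (ν : BanditInstance d n) (k : ℕ) :
    Kernel (History n k) (Fin n × ℝ) :=
  (π.select k) ⊗ₖ (ν.rewardKernel.comap Prod.snd measurable_snd)

instance (π : BanditAlgorithm n) (ν : BanditInstance d n) (k : ℕ) :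
    IsMarkovKernel (π.step ν k) := by
  unfold step; infer_instance

/-- The law of the history of the first `k` rounds when `π` interacts with `ν`. -/
def historyLaw (π : BanditAlgorithm n) (ν : BanditInstance d n) :
    (k : ℕ) → Measure (History n k)
  | 0 => Measure.dirac Fin.elim0
  | k + 1 => ((historyLaw π ν k) ⊗ₘ (π.step ν k)).map
      fun p : History n k × (Fin n × ℝ) =>
        (Fin.snoc (α := fun _ => Fin n × ℝ) p.1 p.2 : History n (k + 1))

theorem measurable_snoc (k : ℕ) :
    Measurable fun p : History n k × (Fin n × ℝ) =>
      (Fin.snoc (α := fun _ => Fin n × ℝ) p.1 p.2 : History n (k + 1)) := by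
  refine measurable_pi_iff.2 fun i => ?_
  induction i using Fin.lastCases with
  | last => simpa using measurable_snd
  | cast i =>
    have h : Measurable fun p : History n k × (Fin n × ℝ) => p.1 i :=
      (measurable_pi_apply i).comp measurable_fst
    simpa using h

instance isProbabilityMeasure_historyLaw (π : BanditAlgorithm n) (ν : BanditInstance d n) (k : ℕ) :
    IsProbabilityMeasure (π.historyLaw ν k) := by
  induction k with
  | zero => unfold historyLaw; infer_instance
  | succ k ih =>
    unfold historyLaw
    exact Measure.isProbabilityMeasure_map (measurable_snoc k).aemeasurable

/-- The expected regret of `π` on `ν` over `K` rounds. -/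
def expectedRegret (π : BanditAlgorithm n) (ν : BanditInstance d n) (K : ℕ) : ℝ :=
  ∫ h, ∑ k : Fin K, (ν.optReward - ν.mean (h k).1) ∂(π.historyLaw ν K)

end BanditAlgorithm

end

/-! The decision set consists of `n` unit vectors with pairwise inner products at most `ε = √(8 log
n / (d - 1))` in absolute value. Such a set exists because random sign vectors are nearly
orthogonal. A reward function that is `Δ` on one arm, `2Δ` on another and zero elsewhere is then
linear up to an error `3Δε`, so the bandit behaves like an unstructured one with `n` arms: an arm is
learned only by pulling it. The class `Θ` is the family of `spiked` instances, indexed by a decoy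
`j` of mean `Δ` and a hidden arm `i` of mean `2Δ` (no hidden arm if `i = j`).

For small `K`, an algorithm facing zero rewards misses most pairs `(j, i)`, and on this event it
cannot tell the spiked instance from the zero one, so every round costs `2Δ`
(`le_expectedRegret_spiked`, then averaging over pairs).

For large `K`, the instances `(j, j)` and `(j, i)` differ only at arm `i`. A Bretagnolle–Huber bound
(`half_mul_exp_le_integral_add_integral`) shows that small regret on both requires about `log K /
Δ²` pulls of `i`. Each pull costs `Δ` in the instance `(j, j)`, and summing over `i` gives
`log_le_expectedRegret_spiked`. Applied with the assumed bound it gives the estimate in terms of `C`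
and `α`; applied with the claimed lower bound itself it gives a contradiction, by `log_div_log_le`.
-/

/-! ### Change of measure between two instances -/

/-- The log-likelihood ratio of the reward `p.2` of the arm `p.1` under `ν'` relative to `ν`. -/
noncomputable def BanditInstance.llr {d n : ℕ} (ν ν' : BanditInstance d n) (p : Fin n × ℝ) : ℝ :=
  (ν'.mean p.1 - ν.mean p.1) * (p.2 - ν.mean p.1) - (ν'.mean p.1 - ν.mean p.1) ^ 2 / 2

theorem measurable_of_fin_prod {n : ℕ} {β : Type*} [MeasurableSpace β] {f : Fin n × ℝ → β}
    (hf : ∀ a, Measurable fun y => f (a, y)) : Measurable f :=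
  measurable_from_prod_countable_right hf

theorem BanditInstance.measurable_llr {d n : ℕ} (ν ν' : BanditInstance d n) :
    Measurable (ν.llr ν') :=
  measurable_of_fin_prod fun a => by unfold BanditInstance.llr; fun_prop

theorem gaussianReal_one_eq_withDensity (m m' : ℝ) :
    gaussianReal m' 1 = (gaussianReal m 1).withDensity
      fun y => ENNReal.ofReal (Real.exp ((m' - m) * (y - m) - (m' - m) ^ 2 / 2)) := by
  rw [gaussianReal_of_var_ne_zero _ one_ne_zero, gaussianReal_of_var_ne_zero _ one_ne_zero,
    ← withDensity_mul _ (measurable_gaussianPDF _ _) (by fun_prop)]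
  congr 1
  ext y
  simp only [gaussianPDF, gaussianPDFReal, Pi.mul_apply]
  rw [← ENNReal.ofReal_mul (by positivity), mul_assoc (_⁻¹) (Real.exp _), ← Real.exp_add]
  congr 3
  push_cast
  ring

namespace BanditAlgorithm

variable {d n : ℕ}

theorem lintegral_historyLaw_succ (π : BanditAlgorithm n) (ν : BanditInstance d n) (k : ℕ)
    {f : History n (k + 1) → ENNReal} (hf : Measurable f) :
    ∫⁻ h, f h ∂(π.historyLaw ν (k + 1)) =
      ∫⁻ h, ∫⁻ a, ∫⁻ y, f (Fin.snoc (α := fun _ => Fin n × ℝ) h (a, y))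
        ∂(gaussianReal (ν.mean a) 1) ∂(π.select k h) ∂(π.historyLaw ν k) := by
  have hs := measurable_snoc (n := n) k
  rw [historyLaw, lintegral_map hf hs, Measure.lintegral_compProd (f := fun p => f (Fin.snoc p.1 p.2)) (hf.comp hs)]
  refine lintegral_congr fun h => ?_
  exact Kernel.lintegral_compProd _ _ _ ((hf.comp hs).comp measurable_prodMk_left)

/-- The selection kernels are the same for both instances and cancel, so only the reward densities
contribute, one factor per round. -/
theorem historyLaw_eq_withDensity (π : BanditAlgorithm n) (ν ν' : BanditInstance d n) (K : ℕ) :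
    π.historyLaw ν' K = (π.historyLaw ν K).withDensity
      fun h => ENNReal.ofReal (Real.exp (∑ k, ν.llr ν' (h k))) := by
  have hL : ∀ K, Measurable fun h : History n K =>
      ENNReal.ofReal (Real.exp (∑ k, ν.llr ν' (h k))) := fun K => by
    have := ν.measurable_llr ν'
    fun_prop
  induction K with
  | zero =>
    simp [historyLaw]
  | succ K ih =>
    have hs := measurable_snoc (n := n) K
    refine Measure.ext_of_lintegral _ fun f hf => ?_
    have hF : Measurable fun h => ∫⁻ a, ∫⁻ y, f (Fin.snoc (α := fun _ => Fin n × ℝ) h (a, y))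
        ∂(gaussianReal (ν'.mean a) 1) ∂(π.select K h) := by
      have := (Measurable.lintegral_kernel_prod_right' (κ := π.step ν' K) (hf.comp hs))
      convert this using 2 with h
      exact (Kernel.lintegral_compProd (π.select K)
        (ν'.rewardKernel.comap Prod.snd measurable_snd) h
        ((hf.comp hs).comp measurable_prodMk_left)).symm
    rw [lintegral_historyLaw_succ _ _ _ hf, ih,
      lintegral_withDensity_eq_lintegral_mul _ (hL K) hF,
      lintegral_withDensity_eq_lintegral_mul _ (hL (K + 1)) hf,
      lintegral_historyLaw_succ _ _ _ ((hL (K + 1)).mul hf)]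
    refine lintegral_congr fun h => ?_
    rw [Pi.mul_apply, ← lintegral_const_mul _ (measurable_of_finite _)]
    refine lintegral_congr fun a => ?_
    have hm : Measurable fun y => f (Fin.snoc (α := fun _ => Fin n × ℝ) h (a, y)) :=
      hf.comp (hs.comp (measurable_prodMk_left.comp measurable_prodMk_left))
    rw [gaussianReal_one_eq_withDensity (ν.mean a) (ν'.mean a),
      lintegral_withDensity_eq_lintegral_mul _ (by fun_prop) hm,
      ← lintegral_const_mul _ ((by fun_prop : Measurable _).mul hm)]
    refine lintegral_congr fun y => ?_
    simp only [Pi.mul_apply, Fin.sum_univ_castSucc, Fin.snoc_castSucc, Fin.snoc_last,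
      Real.exp_add, ENNReal.ofReal_mul (Real.exp_nonneg _), mul_assoc]
    rfl

theorem integral_historyLaw_eq (π : BanditAlgorithm n) (ν ν' : BanditInstance d n) (K : ℕ)
    (f : History n K → ℝ) :
    ∫ h, f h ∂(π.historyLaw ν' K) =
      ∫ h, Real.exp (∑ k, ν.llr ν' (h k)) * f h ∂(π.historyLaw ν K) := by
  have := ν.measurable_llr ν'
  rw [π.historyLaw_eq_withDensity ν ν' K,
    integral_withDensity_eq_integral_toReal_smul (by fun_prop) (by simp)]
  simp [ENNReal.toReal_ofReal (Real.exp_nonneg _)]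

/-- There are only finitely many arm sequences. -/
theorem integrable_arms (π : BanditAlgorithm n) (ν : BanditInstance d n) (K : ℕ)
    (F : (Fin K → Fin n) → ℝ) :
    Integrable (fun h => F fun k => (h k).1) (π.historyLaw ν K) := by
  have hm : Measurable fun (h : History n K) k => (h k).1 := by fun_prop
  exact (Integrable.of_finite (μ := (π.historyLaw ν K).map _) (f := F)).comp_measurable hm

theorem map_init_historyLaw (π : BanditAlgorithm n) (ν : BanditInstance d n) (K : ℕ) :
    (π.historyLaw ν (K + 1)).map (fun h k => h (Fin.castSucc k)) = π.historyLaw ν K := by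
  have hm : Measurable fun (h : History n (K + 1)) (k : Fin K) => h k.castSucc := by fun_prop
  refine Measure.ext_of_lintegral _ fun f hf => ?_
  rw [lintegral_map hf hm, lintegral_historyLaw_succ _ _ _ (f := fun h => f fun k => h k.castSucc) (hf.comp hm)]
  simp

/-- Given the past and the selected arm, the reward has the mean of that arm, so the noise has
conditional mean zero. An earlier round reduces to a shorter history. -/
theorem integral_centered_reward (π : BanditAlgorithm n) (ν : BanditInstance d n)
    (c : Fin n → ℝ) (K : ℕ) (k : Fin K) :
    Integrable (fun h => c (h k).1 * ((h k).2 - ν.mean (h k).1)) (π.historyLaw ν K) ∧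
      ∫ h, c (h k).1 * ((h k).2 - ν.mean (h k).1) ∂(π.historyLaw ν K) = 0 := by
  have hg : Measurable fun p : Fin n × ℝ => c p.1 * (p.2 - ν.mean p.1) :=
    measurable_of_fin_prod fun a => by fun_prop
  have hid : ∀ a, Integrable (fun y : ℝ => y) (gaussianReal (ν.mean a) 1) :=
    fun a => (memLp_id_gaussianReal (μ := ν.mean a) (v := 1) 1).integrable le_rfl
  have hgi : ∀ a, Integrable (fun y => c a * (y - ν.mean a)) (gaussianReal (ν.mean a) 1) :=
    fun a => ((hid a).sub (integrable_const _)).const_mul _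
  have hg0 : ∀ a, ∫ y, c a * (y - ν.mean a) ∂(gaussianReal (ν.mean a) 1) = 0 := fun a => by
    rw [integral_const_mul, integral_sub (hid a) (integrable_const _)]
    simp
  induction K with
  | zero => exact k.elim0
  | succ K ih =>
    induction k using Fin.lastCases with
    | cast k =>
      have hm : Measurable fun (h : History n (K + 1)) (k : Fin K) => h k.castSucc := by fun_prop
      have hG : Measurable fun h : History n K => c (h k).1 * ((h k).2 - ν.mean (h k).1) :=
        hg.comp (measurable_pi_apply k)
      have := ih k
      rw [← map_init_historyLaw] at this
      rw [integrable_map_measure hG.aestronglyMeasurable hm.aemeasurable,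
        integral_map hm.aemeasurable hG.aestronglyMeasurable] at this
      exact this
    | last =>
      have hs := measurable_snoc (n := n) K
      have hG : Measurable fun h : History n (K + 1) =>
          c (h (Fin.last K)).1 * ((h (Fin.last K)).2 - ν.mean (h (Fin.last K)).1) :=
        hg.comp (measurable_pi_apply _)
      have hstep : ∀ h, Integrable (fun p : Fin n × ℝ => c p.1 * (p.2 - ν.mean p.1))
          (π.step ν K h) := fun h => by
        rw [step, ProbabilityTheory.integrable_compProd_iff hg.aestronglyMeasurable]
        exact ⟨Filter.Eventually.of_forall hgi, Integrable.of_finite⟩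
      -- Integrability over the history needs a bound uniform in `h`; summing over the finitely many
      -- arms gives one.
      have hnorm : ∀ h, ∫ p, ‖c p.1 * (p.2 - ν.mean p.1)‖ ∂(π.step ν K h) ≤
          ∑ a, ∫ y, ‖c a * (y - ν.mean a)‖ ∂(gaussianReal (ν.mean a) 1) := fun h => by
        have h1 := (hstep h).norm
        rw [step] at h1 ⊢
        rw [ProbabilityTheory.integral_compProd h1]
        refine (integral_mono Integrable.of_finite (integrable_const _) fun a =>
          Finset.single_le_sum (f := fun a => ∫ y, ‖c a * (y - ν.mean a)‖
            ∂(gaussianReal (ν.mean a) 1)) (fun a _ => integral_nonneg fun y => norm_nonneg _)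
            (Finset.mem_univ a)).trans ?_
        simp
      have hint : Integrable (fun p : History n K × (Fin n × ℝ) =>
          c p.2.1 * (p.2.2 - ν.mean p.2.1)) (π.historyLaw ν K ⊗ₘ π.step ν K) := by
        rw [Measure.integrable_compProd_iff
          (f := fun p : History n K × (Fin n × ℝ) => c p.2.1 * (p.2.2 - ν.mean p.2.1)) (hg.comp measurable_snd).aestronglyMeasurable]
        refine ⟨Filter.Eventually.of_forall hstep, ?_⟩
        refine Integrable.of_bound (C := ∑ a, ∫ y, ‖c a * (y - ν.mean a)‖
          ∂(gaussianReal (ν.mean a) 1)) ?_ (Filter.Eventually.of_forall fun h => ?_)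
        · exact ((hg.norm.comp measurable_snd).stronglyMeasurable.integral_kernel_prod_right'
            (κ := π.step ν K)).aestronglyMeasurable
        · rw [Real.norm_of_nonneg (integral_nonneg fun _ => norm_nonneg _)]
          exact hnorm h
      rw [historyLaw, integrable_map_measure hG.aestronglyMeasurable hs.aemeasurable,
        integral_map hs.aemeasurable hG.aestronglyMeasurable]
      simp only [Function.comp_def, Fin.snoc_last]
      refine ⟨hint, ?_⟩
      rw [Measure.integral_compProd hint]
      refine integral_eq_zero_of_ae (Filter.Eventually.of_forall fun h => ?_)
      have h1 := hstep h
      change ∫ p, c p.1 * (p.2 - ν.mean p.1) ∂(π.step ν K h) = 0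
      rw [step] at h1 ⊢
      rw [ProbabilityTheory.integral_compProd h1]
      exact integral_eq_zero_of_ae (Filter.Eventually.of_forall hg0)

theorem integral_exp_sum_llr (π : BanditAlgorithm n) (ν ν' : BanditInstance d n) (K : ℕ) :
    Integrable (fun h => Real.exp (∑ k, ν.llr ν' (h k))) (π.historyLaw ν K) ∧
      ∫ h, Real.exp (∑ k, ν.llr ν' (h k)) ∂(π.historyLaw ν K) = 1 := by
  have h1 : ∫ h, Real.exp (∑ k, ν.llr ν' (h k)) ∂(π.historyLaw ν K) = 1 := by
    simpa using (π.integral_historyLaw_eq ν ν' K fun _ => 1).symm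
  -- A non-integrable function has integral zero by convention, so the value `1` already yields
  -- integrability.
  exact ⟨Integrable.of_integral_ne_zero (by rw [h1]; exact one_ne_zero), h1⟩

/-- This is the divergence decomposition: the noise terms average out, and round by round the
Gaussian divergences remain. -/
theorem integral_sum_llr (π : BanditAlgorithm n) (ν ν' : BanditInstance d n) (K : ℕ) :
    Integrable (fun h => ∑ k, ν.llr ν' (h k)) (π.historyLaw ν K) ∧
      ∫ h, ∑ k, ν.llr ν' (h k) ∂(π.historyLaw ν K) =
        -∫ h, ∑ k, (ν'.mean (h k).1 - ν.mean (h k).1) ^ 2 / 2 ∂(π.historyLaw ν K) := by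
  have hc := fun k => π.integral_centered_reward ν (fun a => ν'.mean a - ν.mean a) K k
  have hq := π.integrable_arms ν K fun s => ∑ k, (ν'.mean (s k) - ν.mean (s k)) ^ 2 / 2
  simp only [BanditInstance.llr, Finset.sum_sub_distrib]
  have hi := integrable_finsetSum Finset.univ fun k _ => (hc k).1
  refine ⟨hi.sub hq, ?_⟩
  rw [integral_sub hi hq, integral_finsetSum _ fun k _ => (hc k).1]
  simp [(hc _).2]

/-! ### The Bretagnolle–Huber inequality -/

/-- With `T = exp t` and `s = exp (x / 2)`, tangency of the exponential reduces this to two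
completed squares, `(T * s / 2 - 1)²` and `(T / 2 - s)²`. The left side is linear in `x` and `exp
x`, so it can be integrated directly, in place of Cauchy–Schwarz and Jensen. -/
theorem min_one_exp_ge (x : ℝ) (t : ℝ) :
    Real.exp (2 * t) * (1 + x / 2 - t) - (1 + Real.exp x) * (Real.exp (2 * t) / 4) ≤
      min 1 (Real.exp x) := by
  have hx : Real.exp x = Real.exp (x / 2) ^ 2 := by rw [← Real.exp_nat_mul]; ring_nf
  have ht : Real.exp (2 * t) = Real.exp t ^ 2 := by rw [← Real.exp_nat_mul]; ring_nf
  have h1 : Real.exp t * (1 + x / 2 - t) ≤ Real.exp (x / 2) := by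
    have h2 := Real.add_one_le_exp (x / 2 - t)
    have h3 : Real.exp (x / 2) = Real.exp t * Real.exp (x / 2 - t) := by
      rw [← Real.exp_add]; ring_nf
    rw [h3]
    exact mul_le_mul_of_nonneg_left (by linarith) (Real.exp_nonneg _)
  rw [hx, ht]
  set T := Real.exp t
  set s := Real.exp (x / 2)
  have hT : 0 < T := Real.exp_pos _
  have h4 : T ^ 2 * (1 + x / 2 - t) ≤ T * s := by nlinarith
  refine le_min ?_ ?_
  · nlinarith [sq_nonneg (T * s / 2 - 1), sq_nonneg T]
  · nlinarith [sq_nonneg (T / 2 - s), sq_nonneg (T * s)]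

/-- A form of the Bretagnolle–Huber inequality together with the divergence decomposition. -/
theorem half_mul_exp_le_integral_add_integral (π : BanditAlgorithm n) (ν ν' : BanditInstance d n)
    (K : ℕ) (F F' : (Fin K → Fin n) → ℝ) (hF : ∀ s, 0 ≤ F s) (hF' : ∀ s, 0 ≤ F' s) {c : ℝ}
    (hc : 0 ≤ c) (hFF' : ∀ s, c ≤ F s ∨ c ≤ F' s) :
    c / 2 * Real.exp (-∫ h, ∑ k, (ν'.mean (h k).1 - ν.mean (h k).1) ^ 2 / 2
        ∂(π.historyLaw ν K)) ≤
      ∫ h, F (fun k => (h k).1) ∂(π.historyLaw ν K) +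
        ∫ h, F' (fun k => (h k).1) ∂(π.historyLaw ν' K) := by
  obtain ⟨hLi, hL⟩ := π.integral_exp_sum_llr ν ν' K
  obtain ⟨hXi, hX⟩ := π.integral_sum_llr ν ν' K
  rw [← hX]
  set X : History n K → ℝ := fun h => ∑ k, ν.llr ν' (h k) with hXdef
  -- With `t` half the mean of `X`, the factor `1 + X / 2 - t` has mean `1` and `1 + exp X` has mean
  -- `2`, which leaves `exp (2 * t) / 2`.
  set t : ℝ := (∫ h, X h ∂(π.historyLaw ν K)) / 2 with ht
  have h2t : ∫ h, X h ∂(π.historyLaw ν K) = 2 * t := by rw [ht]; ring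
  rw [π.integral_historyLaw_eq ν ν' K]
  have hF'i : Integrable (fun h => Real.exp (X h) * F' fun k => (h k).1) (π.historyLaw ν K) := by
    have h1 := π.integrable_arms ν' K F'
    have := ν.measurable_llr ν'
    rw [π.historyLaw_eq_withDensity ν ν' K, integrable_withDensity_iff_integrable_smul'
      (by fun_prop) (by simp)] at h1
    simpa [ENNReal.toReal_ofReal (Real.exp_nonneg _)] using h1
  rw [← integral_add (π.integrable_arms ν K F) hF'i]
  have hXi2 : Integrable (fun h => 1 + X h / 2) (π.historyLaw ν K) :=
    (integrable_const _).add (hXi.div_const 2)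
  have hi1 : Integrable (fun h => Real.exp (2 * t) * (1 + X h / 2 - t)) (π.historyLaw ν K) :=
    (hXi2.sub (integrable_const _)).const_mul _
  have hi2 : Integrable (fun h => (1 + Real.exp (X h)) * (Real.exp (2 * t) / 4))
      (π.historyLaw ν K) := ((integrable_const _).add hLi).mul_const _
  have hval : ∫ h, c * (Real.exp (2 * t) * (1 + X h / 2 - t) -
      (1 + Real.exp (X h)) * (Real.exp (2 * t) / 4)) ∂(π.historyLaw ν K) =
      c / 2 * Real.exp (2 * t) := by
    rw [integral_const_mul, integral_sub hi1 hi2, integral_const_mul, integral_mul_const,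
      integral_sub hXi2 (integrable_const _),
      integral_add (integrable_const _) (hXi.div_const 2), integral_add (integrable_const _) hLi,
      integral_div, h2t, hL]
    simp
    ring
  rw [h2t, ← hval]
  refine integral_mono ((hi1.sub hi2).const_mul c) ((π.integrable_arms ν K F).add hF'i)
    fun h => ?_
  -- Since `F` or `F'` is at least `c`, the sum `F + exp X * F'` dominates `c * min 1 (exp X)`.
  refine (mul_le_mul_of_nonneg_left (min_one_exp_ge (X h) t) hc).trans ?_
  have hpos := Real.exp_pos (X h)
  rcases hFF' fun k => (h k).1 with h1 | h1
  · nlinarith [min_le_left 1 (Real.exp (X h)), mul_nonneg hpos.le (hF' fun k => (h k).1)]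
  · nlinarith [min_le_right 1 (Real.exp (X h)), hF fun k => (h k).1]

/-- The probability of pulling only arms on which two instances agree is the same for both. -/
theorem integral_eq_of_agree (π : BanditAlgorithm n) (ν ν' : BanditInstance d n) (K : ℕ)
    (F : (Fin K → Fin n) → ℝ) (hF : ∀ s, F s ≠ 0 → ∀ k, ν'.mean (s k) = ν.mean (s k)) :
    ∫ h, F (fun k => (h k).1) ∂(π.historyLaw ν' K) =
      ∫ h, F (fun k => (h k).1) ∂(π.historyLaw ν K) := by
  rw [π.integral_historyLaw_eq ν ν' K]
  congr 1
  ext h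
  by_cases h0 : F (fun k => (h k).1) = 0
  · simp [h0]
  · simp [BanditInstance.llr, hF _ h0]

end BanditAlgorithm

/-! ### Nearly orthogonal unit vectors -/

/-- The sign `1` or `-1` of a bit. -/
def boolSign (b : Bool) : ℝ := if b then 1 else -1

theorem boolSign_mul_self (b : Bool) : boolSign b * boolSign b = 1 := by
  cases b <;> simp [boolSign]

/-- Chernoff's bound by counting: the exponential moment with parameter `ε` factors into terms `cosh
(ε * c i) ≤ exp (ε² / 2)`, and Markov's inequality does the rest. -/
theorem card_sum_boolSign_gt_le {d : ℕ} (c : Fin d → ℝ) (hc : ∀ i, c i * c i = 1) {ε : ℝ}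
    (hε : 0 ≤ ε) :
    (((Finset.univ : Finset (Fin d → Bool)).filter fun v =>
      ε * d < ∑ i, c i * boolSign (v i)).card : ℝ) ≤ Real.exp (-(ε ^ 2 * d / 2)) * 2 ^ d := by
  have hprod : ∑ v : Fin d → Bool, Real.exp (ε * ∑ i, c i * boolSign (v i)) ≤
      Real.exp (ε ^ 2 * d / 2) * 2 ^ d := by
    have h1 : ∀ v : Fin d → Bool, Real.exp (ε * ∑ i, c i * boolSign (v i)) =
        ∏ i, Real.exp (ε * (c i * boolSign (v i))) := fun v => by
      rw [Finset.mul_sum, Real.exp_sum]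
    have h2 : ∀ i, ∑ b : Bool, Real.exp (ε * (c i * boolSign b)) ≤
        Real.exp (ε ^ 2 / 2) * 2 := fun i => by
      have h3 := Real.cosh_le_exp_half_sq (ε * c i)
      rw [Real.cosh_eq, mul_pow, sq (c i), hc, mul_one] at h3
      simp only [Fintype.sum_bool, boolSign]
      simp only [if_true, mul_one, mul_neg, Bool.false_eq_true, if_false]
      linarith
    simp only [h1]
    rw [← Fintype.prod_sum fun (i : Fin d) (b : Bool) => Real.exp (ε * (c i * boolSign b))]
    refine (Finset.prod_le_prod (fun i _ => Finset.sum_nonneg fun b _ => Real.exp_nonneg _)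
      fun i _ => h2 i).trans ?_
    rw [Finset.prod_const, Finset.card_univ, Fintype.card_fin, mul_pow, ← Real.exp_nat_mul]
    apply le_of_eq
    ring_nf
  have hcard : (((Finset.univ : Finset (Fin d → Bool)).filter fun v =>
      ε * d < ∑ i, c i * boolSign (v i)).card : ℝ) * Real.exp (ε ^ 2 * d) ≤
      ∑ v : Fin d → Bool, Real.exp (ε * ∑ i, c i * boolSign (v i)) := by
    rw [← nsmul_eq_mul]
    refine (Finset.card_nsmul_le_sum _ _ _ fun v hv => ?_).trans
      (Finset.sum_le_sum_of_subset_of_nonneg (Finset.filter_subset _ _)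
        fun _ _ _ => Real.exp_nonneg _)
    rw [Finset.mem_filter] at hv
    refine Real.exp_le_exp.2 ?_
    nlinarith [hv.2]
  have h := hcard.trans hprod
  have he : Real.exp (-(ε ^ 2 * d / 2)) * Real.exp (ε ^ 2 * d) = Real.exp (ε ^ 2 * d / 2) := by
    rw [← Real.exp_add]; ring_nf
  rw [← he, mul_right_comm] at h
  exact le_of_mul_le_mul_right h (Real.exp_pos _)

theorem card_abs_sum_boolSign_gt_le {d : ℕ} (u : Fin d → Bool) {ε : ℝ} (hε : 0 ≤ ε) :
    (((Finset.univ : Finset (Fin d → Bool)).filter fun v =>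
      ε * d < |∑ i, boolSign (u i) * boolSign (v i)|).card : ℝ) ≤
      2 * (Real.exp (-(ε ^ 2 * d / 2)) * 2 ^ d) := by
  have h1 := card_sum_boolSign_gt_le (fun i => boolSign (u i))
    (fun i => boolSign_mul_self _) hε
  have h2 := card_sum_boolSign_gt_le (fun i => -boolSign (u i))
    (fun i => by rw [neg_mul_neg]; exact boolSign_mul_self _) hε
  have h3 : ((Finset.univ : Finset (Fin d → Bool)).filter fun v =>
      ε * d < |∑ i, boolSign (u i) * boolSign (v i)|) ⊆
      ((Finset.univ : Finset (Fin d → Bool)).filter fun v =>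
        ε * d < ∑ i, boolSign (u i) * boolSign (v i)) ∪
      ((Finset.univ : Finset (Fin d → Bool)).filter fun v =>
        ε * d < ∑ i, -boolSign (u i) * boolSign (v i)) := fun v hv => by
    simpa [lt_abs] using hv
  have h4 := (Finset.card_le_card h3).trans (Finset.card_union_le _ _)
  have h5 : (((Finset.univ : Finset (Fin d → Bool)).filter fun v =>
      ε * d < |∑ i, boolSign (u i) * boolSign (v i)|).card : ℝ) ≤ _ := Nat.cast_le.2 h4
  push_cast at h5
  linarith

/-- Greedy choice: each chosen vector excludes at most a fraction `2 * exp (-(ε² d / 2))` of the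
cube, so fewer than `n` of them cannot exclude everything. -/
theorem exists_finset_nearly_orthogonal_signs {d n : ℕ} {ε : ℝ} (hd : 0 < d) (hε : 0 ≤ ε)
    (hε1 : ε < 1) (hn : 2 * n * Real.exp (-(ε ^ 2 * d / 2)) < 1) (m : ℕ) (hm : m ≤ n) :
    ∃ S : Finset (Fin d → Bool), S.card = m ∧ ∀ u ∈ S, ∀ v ∈ S, u ≠ v →
      |∑ i, boolSign (u i) * boolSign (v i)| ≤ ε * d := by
  induction m with
  | zero => exact ⟨∅, by simp⟩
  | succ m ih =>
    obtain ⟨S, hS, hgood⟩ := ih (by omega)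
    let bad : (Fin d → Bool) → Finset (Fin d → Bool) := fun u =>
      Finset.univ.filter fun v => ε * d < |∑ i, boolSign (u i) * boolSign (v i)|
    have hcard : ((S.biUnion bad).card : ℝ) < (Finset.univ : Finset (Fin d → Bool)).card := by
      have h1 : ((S.biUnion bad).card : ℝ) ≤ ∑ u ∈ S, ((bad u).card : ℝ) := by
        exact_mod_cast Finset.card_biUnion_le
      refine (h1.trans (Finset.sum_le_sum fun u _ => card_abs_sum_boolSign_gt_le u hε)).trans_lt ?_
      rw [Finset.sum_const, hS, nsmul_eq_mul, Finset.card_univ, Fintype.card_fun,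
        Fintype.card_bool, Fintype.card_fin]
      push_cast
      have h2 : (m : ℝ) ≤ n := by exact_mod_cast (by omega : m ≤ n)
      have h3 : (0 : ℝ) < 2 ^ d := by positivity
      have h4 := Real.exp_pos (-(ε ^ 2 * d / 2))
      have h5 : (m : ℝ) * (2 * Real.exp (-(ε ^ 2 * d / 2))) < 1 := by nlinarith
      nlinarith
    obtain ⟨v, -, hv⟩ := Finset.exists_mem_notMem_of_card_lt_card (by exact_mod_cast hcard)
    have hv' : ∀ u ∈ S, |∑ i, boolSign (u i) * boolSign (v i)| ≤ ε * d := fun u hu => by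
      by_contra hlt
      exact hv (Finset.mem_biUnion.2 ⟨u, hu, by simpa [bad] using hlt⟩)
    -- A vector has product `d > ε * d` with itself, so it excludes itself; this is where `ε < 1`
    -- enters.
    have hvS : v ∉ S := fun hvS => by
      have := hv' v hvS
      simp only [boolSign_mul_self] at this
      simp at this
      have : (0 : ℝ) < d := by exact_mod_cast hd
      nlinarith
    refine ⟨insert v S, by rw [Finset.card_insert_of_notMem hvS, hS], ?_⟩
    intro a ha b hb hab
    rw [Finset.mem_insert] at ha hb
    rcases ha with rfl | ha <;> rcases hb with rfl | hb
    · exact absurd rfl hab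
    · simpa only [mul_comm] using hv' b hb
    · exact hv' a ha
    · exact hgood a ha b hb hab

/-- The points lie on a circle at angles in `[0, 1]`, where the cosine is injective. This serves the
regime `1 ≤ ε`, where near orthogonality is just Cauchy–Schwarz. -/
theorem exists_embedding_unit_vectors {d : ℕ} (hd : 2 ≤ d) (n : ℕ) :
    ∃ x : Fin n ↪ EuclideanSpace ℝ (Fin d), ∀ a, ‖x a‖ = 1 := by
  let i₀ : Fin d := ⟨0, by omega⟩
  let i₁ : Fin d := ⟨1, by omega⟩
  have hi : i₁ ≠ i₀ := by simp [i₀, i₁]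
  let y : ℝ → EuclideanSpace ℝ (Fin d) := fun t =>
    EuclideanSpace.single i₀ (Real.cos t) + EuclideanSpace.single i₁ (Real.sin t)
  have hy : ∀ t, ‖y t‖ = 1 := fun t => by
    have h := norm_add_sq_real (EuclideanSpace.single i₀ (Real.cos t))
      (EuclideanSpace.single i₁ (Real.sin t))
    have h1 : ‖y t‖ ^ 2 = 1 := by
      simp only [y, h]
      simp [EuclideanSpace.inner_single_left, hi.symm]
    exact (sq_eq_sq₀ (norm_nonneg _) zero_le_one).1 (by rw [h1, one_pow])
  have hinj : Function.Injective fun a : Fin n => y ((a : ℝ) / n) := fun a b hab => by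
    have h0 : Real.cos ((a : ℝ) / n) = Real.cos ((b : ℝ) / n) := by
      have := congrArg (fun v : EuclideanSpace ℝ (Fin d) => v i₀) hab
      simpa [y, hi, hi.symm] using this
    have hmem : ∀ a : Fin n, ((a : ℝ) / n) ∈ Set.Icc 0 Real.pi := fun a => by
      refine ⟨by positivity, (div_le_one_of_le₀ ?_ (by positivity)).trans ?_⟩
      · exact_mod_cast a.2.le
      · linarith [Real.pi_gt_three]
    have h1 := Real.injOn_cos (hmem a) (hmem b) h0
    have hn : (n : ℝ) ≠ 0 := by
      have := a.2
      exact_mod_cast (by omega : n ≠ 0)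
    rw [div_left_inj' hn] at h1
    exact Fin.ext (by exact_mod_cast h1)
  exact ⟨⟨_, hinj⟩, fun a => hy _⟩

theorem exists_nearly_orthogonal_unit_vectors {d n : ℕ} (hd : 2 ≤ d) (hn : 2 ≤ n) :
    ∃ x : Fin n ↪ EuclideanSpace ℝ (Fin d), (∀ a, ‖x a‖ = 1) ∧
      ∀ a b, a ≠ b → |inner ℝ (x a) (x b)| ≤
        Real.sqrt (8 * Real.log (n : ℝ) / ((d : ℝ) - 1)) := by
  set ε := Real.sqrt (8 * Real.log (n : ℝ) / ((d : ℝ) - 1)) with hεdef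
  have hdR : (2 : ℝ) ≤ d := by exact_mod_cast hd
  have hnR : (2 : ℝ) ≤ n := by exact_mod_cast hn
  have hlog : 0 < Real.log n := Real.log_pos (by linarith)
  rcases le_or_gt 1 ε with hε | hε
  · obtain ⟨x, hx⟩ := exists_embedding_unit_vectors hd n
    refine ⟨x, hx, fun a b _ => (abs_real_inner_le_norm _ _).trans ?_⟩
    rw [hx, hx, one_mul]
    exact hε
  · have hε0 : 0 ≤ ε := Real.sqrt_nonneg _
    have hsq : ε ^ 2 * ((d : ℝ) - 1) = 8 * Real.log n := by
      rw [hεdef, Real.sq_sqrt (div_nonneg (by linarith) (by linarith))]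
      exact div_mul_cancel₀ _ (by linarith)
    -- From `ε² (d - 1) = 8 log n`, the exponent `ε² d / 2` is at least `4 log n`.
    have hexp : Real.exp (-(ε ^ 2 * d / 2)) ≤ ((n : ℝ) ^ 4)⁻¹ := by
      have h1 : ((n : ℝ) ^ 4)⁻¹ = Real.exp (-(4 * Real.log n)) := by
        rw [Real.exp_neg]
        congr 1
        rw [show (4 : ℝ) = ((4 : ℕ) : ℝ) by norm_num, Real.exp_nat_mul,
          Real.exp_log (by linarith)]
      rw [h1]
      refine Real.exp_le_exp.2 ?_
      nlinarith [sq_nonneg ε]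
    have hn1 : 2 * n * Real.exp (-(ε ^ 2 * d / 2)) < 1 := by
      have h4 : (0 : ℝ) < (n : ℝ) ^ 4 := by positivity
      have h5 : 2 * (n : ℝ) < (n : ℝ) ^ 4 := by nlinarith [sq_nonneg ((n : ℝ) ^ 2 - 4)]
      calc 2 * n * Real.exp (-(ε ^ 2 * d / 2)) ≤ 2 * n * ((n : ℝ) ^ 4)⁻¹ := by gcongr
        _ < 1 := by rw [← div_eq_mul_inv, div_lt_one h4]; exact h5
    obtain ⟨S, hS, hgood⟩ := exists_finset_nearly_orthogonal_signs (by omega) hε0 hε hn1 n le_rfl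
    let e : Fin n ↪ (Fin d → Bool) :=
      (S.equivFinOfCardEq hS).symm.toEmbedding.trans (Function.Embedding.subtype _)
    have he : ∀ a, e a ∈ S := fun a => ((S.equivFinOfCardEq hS).symm a).2
    let x : Fin n → EuclideanSpace ℝ (Fin d) := fun a =>
      WithLp.toLp 2 fun i => boolSign (e a i) / Real.sqrt d
    have hinner : ∀ a b, inner ℝ (x a) (x b) =
        (∑ i, boolSign (e a i) * boolSign (e b i)) / d := fun a b => by
      simp only [x, PiLp.inner_apply, RCLike.inner_apply, conj_trivial, Finset.sum_div]
      refine Finset.sum_congr rfl fun i _ => ?_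
      rw [div_mul_div_comm, Real.mul_self_sqrt (by linarith), mul_comm]
    have hnorm : ∀ a, ‖x a‖ = 1 := fun a => by
      have h1 : ‖x a‖ ^ 2 = 1 := by
        rw [← real_inner_self_eq_norm_sq, hinner]
        simp only [boolSign_mul_self]
        simp
        omega
      exact (sq_eq_sq₀ (norm_nonneg _) zero_le_one).1 (by rw [h1, one_pow])
    have hin : ∀ a b, a ≠ b → |inner ℝ (x a) (x b)| ≤ ε := fun a b hab => by
      rw [hinner, abs_div, abs_of_nonneg (by linarith : (0 : ℝ) ≤ d), div_le_iff₀ (by linarith)]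
      exact hgood _ (he a) _ (he b) fun h => hab (e.injective h)
    have hinj : Function.Injective x := fun a b hab => by
      by_contra hne
      have h1 := hin a b hne
      rw [← hab, real_inner_self_eq_norm_sq, hnorm] at h1
      norm_num at h1
      linarith
    exact ⟨⟨x, hinj⟩, hnorm, hin⟩

/-! ### Expected pulls and the regret decomposition -/

namespace BanditAlgorithm

variable {d n : ℕ}

/-- The expected number of pulls of the arm `a` in the first `K` rounds. -/
noncomputable def expectedPulls (π : BanditAlgorithm n) (ν : BanditInstance d n) (K : ℕ)
    (a : Fin n) : ℝ :=
  ∫ h, ∑ k : Fin K, (if (h k).1 = a then 1 else 0) ∂(π.historyLaw ν K)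

theorem integral_sum_arms (π : BanditAlgorithm n) (ν : BanditInstance d n) (K : ℕ)
    (f : Fin n → ℝ) :
    ∫ h, ∑ k : Fin K, f (h k).1 ∂(π.historyLaw ν K) = ∑ a, f a * π.expectedPulls ν K a := by
  simp only [expectedPulls, ← integral_const_mul]
  rw [← integral_finsetSum _ fun a _ => π.integrable_arms ν K
    fun s => f a * ∑ k : Fin K, (if s k = a then 1 else 0)]
  congr 1
  ext h
  simp only [Finset.mul_sum]
  rw [Finset.sum_comm]
  simp

theorem expectedPulls_nonneg (π : BanditAlgorithm n) (ν : BanditInstance d n) (K : ℕ)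
    (a : Fin n) : 0 ≤ π.expectedPulls ν K a :=
  integral_nonneg fun _ => Finset.sum_nonneg fun _ _ => by split_ifs <;> norm_num

theorem sum_expectedPulls (π : BanditAlgorithm n) (ν : BanditInstance d n) (K : ℕ) :
    ∑ a, π.expectedPulls ν K a = K := by
  simpa using (π.integral_sum_arms ν K fun _ => 1).symm

theorem expectedRegret_eq_sum (π : BanditAlgorithm n) (ν : BanditInstance d n) (K : ℕ) :
    π.expectedRegret ν K = ∑ a, ν.gap a * π.expectedPulls ν K a :=
  π.integral_sum_arms ν K ν.gap

end BanditAlgorithm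

/-! ### The spiked family -/

namespace BanditInstance

variable {d n : ℕ}

theorem gap_nonneg (ν : BanditInstance d n) (a : Fin n) : 0 ≤ ν.gap a :=
  sub_nonneg.2 (le_ciSup (Set.finite_range _).bddAbove a)

theorem optReward_eq (ν : BanditInstance d n) (b : Fin n) (hb : ∀ a, ν.mean a ≤ ν.mean b) :
    ν.optReward = ν.mean b := by
  have : Nonempty (Fin n) := ⟨b⟩
  exact le_antisymm (ciSup_le hb) (le_ciSup (Set.finite_range _).bddAbove b)

/-- The instance in which arm `j` has mean `Δ`, arm `i` has mean `2 * Δ` if `i ≠ j`, and all other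
arms have mean zero. -/
noncomputable def spiked (x : Fin n → EuclideanSpace ℝ (Fin d)) (Δ : ℝ) (j i : Fin n) :
    BanditInstance d n where
  param := Δ • x j + (if i = j then 0 else 2 * Δ) • x i
  mean a := if a = j then Δ else if a = i then 2 * Δ else 0

section spiked

variable (x : Fin n → EuclideanSpace ℝ (Fin d)) {Δ : ℝ}

theorem optReward_spiked_self (hΔ : 0 < Δ) (j : Fin n) : (spiked x Δ j j).optReward = Δ := by
  rw [optReward_eq _ j fun a => ?_]
  · simp [spiked]
  · by_cases h : a = j <;> simp [spiked, h, hΔ.le]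

theorem optReward_spiked (hΔ : 0 < Δ) {j i : Fin n} (hij : i ≠ j) :
    (spiked x Δ j i).optReward = 2 * Δ := by
  rw [optReward_eq _ i fun a => ?_]
  · simp [spiked, hij]
  · by_cases h : a = j
    · simp [spiked, h, hij]; linarith
    · by_cases h' : a = i <;> simp [spiked, h, h', hij, hΔ.le]

theorem gap_spiked_self (hΔ : 0 < Δ) (j a : Fin n) :
    (spiked x Δ j j).gap a = if a = j then 0 else Δ := by
  rw [gap, optReward_spiked_self x hΔ]
  by_cases h : a = j <;> simp [spiked, h]

theorem gap_spiked (hΔ : 0 < Δ) {j i : Fin n} (hij : i ≠ j) (a : Fin n) :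
    (spiked x Δ j i).gap a = if a = j then Δ else if a = i then 0 else 2 * Δ := by
  rw [gap, optReward_spiked x hΔ hij]
  by_cases h : a = j
  · simp [spiked, h]; ring
  · by_cases h' : a = i <;> simp [spiked, h, h', hij]

theorem hasMinGap_spiked (hΔ : 0 < Δ) (hn : 2 ≤ n) (j i : Fin n) :
    (spiked x Δ j i).HasMinGap Δ := by
  have : Nontrivial (Fin n) := Fin.nontrivial_iff_two_le.2 hn
  by_cases hij : i = j
  · subst hij
    refine ⟨⟨hΔ, ?_⟩, ?_⟩
    · obtain ⟨a, ha⟩ := exists_ne i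
      exact ⟨a, by simp [gap_spiked_self x hΔ, ha]⟩
    · rintro δ ⟨hδ, a, rfl⟩
      rw [gap_spiked_self x hΔ] at hδ ⊢
      split_ifs at hδ ⊢ <;> linarith
  · refine ⟨⟨hΔ, j, by simp [gap_spiked x hΔ hij]⟩, ?_⟩
    rintro δ ⟨hδ, a, rfl⟩
    rw [gap_spiked x hΔ hij] at hδ ⊢
    split_ifs at hδ ⊢ <;> linarith

/-- The decoy `j` is the only arm of mean `Δ`, and a hidden arm is the only one of mean `2Δ`. Hence
averages over the family are averages over all `n²` pairs. -/
theorem spiked_injective (hΔ : 0 < Δ) :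
    Function.Injective fun p : Fin n × Fin n => spiked x Δ p.1 p.2 := by
  rintro ⟨j, i⟩ ⟨j', i'⟩ h
  have hm : ∀ a, (spiked x Δ j i).mean a = (spiked x Δ j' i').mean a := fun a =>
    congrFun (congrArg BanditInstance.mean h) a
  simp only [spiked] at hm
  have h1 : j = j' := by
    have := hm j
    by_contra hne
    simp only [if_true, if_neg hne] at this
    split_ifs at this <;> linarith
  subst h1
  have h2 : i = i' := by
    by_contra hne
    have h3 := hm i
    have h4 := hm i'
    simp only [if_true, if_neg hne, if_neg (Ne.symm hne)] at h3 h4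
    by_cases h5 : i = j
    · subst h5
      simp only [if_neg (Ne.symm hne)] at h4
      linarith
    · simp only [if_neg h5] at h3
      linarith
  rw [h2]

theorem norm_param_spiked_le (hΔ : 0 < Δ) (hx : ∀ a, ‖x a‖ = 1) (j i : Fin n) :
    ‖(spiked x Δ j i).param‖ ≤ 3 * Δ := by
  refine (norm_add_le _ _).trans ?_
  rw [norm_smul, norm_smul, hx, hx, Real.norm_of_nonneg hΔ.le, mul_one, mul_one]
  split_ifs
  · simp; linarith
  · rw [Real.norm_of_nonneg (by linarith)]; linarith

theorem mean_spiked_mem (hΔ : 0 < Δ) (j i a : Fin n) :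
    0 ≤ (spiked x Δ j i).mean a ∧ (spiked x Δ j i).mean a ≤ 2 * Δ := by
  simp only [spiked]
  split_ifs <;> constructor <;> linarith

/-- For orthonormal arms the means would be exactly linear. The coefficients `Δ` and `2Δ` turn the
inner products of distinct arms into an error of at most `3Δε`. -/
theorem isMisspecified_spiked (hΔ : 0 < Δ) (hx : ∀ a, ‖x a‖ = 1) {ε ζ : ℝ} (hε : 0 ≤ ε)
    (hxε : ∀ a b, a ≠ b → |inner ℝ (x a) (x b)| ≤ ε) (hζ : 3 * Δ * ε ≤ ζ) (j i : Fin n) :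
    (spiked x Δ j i).IsMisspecified x ζ := by
  intro a
  refine le_trans ?_ hζ
  have hself : ∀ a, inner ℝ (x a) (x a) = 1 := fun a => by
    rw [real_inner_self_eq_norm_sq, hx]; norm_num
  have hΔε : 0 ≤ Δ * ε := by positivity
  simp only [spiked, inner_add_right, inner_smul_right]
  by_cases hij : i = j
  · subst hij
    by_cases ha : a = i
    · subst ha
      simp only [if_true, hself]
      rw [abs_le]; constructor <;> linarith
    · have h1 := abs_le.1 (hxε a i ha)
      simp only [if_true, if_neg ha]
      rw [abs_le]; constructor <;> nlinarith
  · simp only [if_neg hij]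
    by_cases ha : a = j
    · subst ha
      have h1 := abs_le.1 (hxε a i (Ne.symm hij))
      simp only [if_true, hself]
      rw [abs_le]; constructor <;> nlinarith
    · have h1 := abs_le.1 (hxε a j ha)
      simp only [if_neg ha]
      by_cases ha' : a = i
      · subst ha'
        simp only [if_true, hself]
        rw [abs_le]; constructor <;> nlinarith
      · have h2 := abs_le.1 (hxε a i ha')
        simp only [if_neg ha']
        rw [abs_le]; constructor <;> nlinarith

end spiked

end BanditInstance

/-! ### Regret lower bounds on the spiked family -/

namespace BanditAlgorithm

open BanditInstance

variable {d n : ℕ} (π : BanditAlgorithm n) (x : Fin n → EuclideanSpace ℝ (Fin d)) {Δ : ℝ}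

theorem expectedRegret_nonneg (ν : BanditInstance d n) (K : ℕ) : 0 ≤ π.expectedRegret ν K :=
  integral_nonneg fun _ => Finset.sum_nonneg fun _ _ => ν.gap_nonneg _

/-- The arms `j` and `i` can only be recognized by pulling them, so that the regret is almost
maximal if they are rarely pulled when all arms have mean zero. -/
theorem le_expectedRegret_spiked (hΔ : 0 < Δ) {j i : Fin n} (hij : i ≠ j) (K : ℕ) :
    2 * Δ * K * (1 - π.expectedPulls (⟨0, 0⟩ : BanditInstance d n) K j -
      π.expectedPulls (⟨0, 0⟩ : BanditInstance d n) K i) ≤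
      π.expectedRegret (spiked x Δ j i) K := by
  classical
  -- Indicator that neither special arm is ever pulled: its probability agrees with that under zero
  -- means, and on it each round costs `2Δ`.
  let E : (Fin K → Fin n) → ℝ := fun s => if ∀ k, s k ≠ j ∧ s k ≠ i then 1 else 0
  let N : Fin n → (Fin K → Fin n) → ℝ := fun a s => ∑ k, if s k = a then 1 else 0
  have hN : ∀ a s, 0 ≤ N a s := fun a s =>
    Finset.sum_nonneg fun _ _ => by split_ifs <;> norm_num
  have hN1 : ∀ a s k, s k = a → 1 ≤ N a s := fun a s k hk => by
    have := Finset.single_le_sum (f := fun k => if s k = a then (1 : ℝ) else 0)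
      (fun _ _ => by split_ifs <;> norm_num) (Finset.mem_univ k)
    rwa [if_pos hk] at this
  have h1 : ∫ h, E (fun k => (h k).1) ∂(π.historyLaw (spiked x Δ j i) K) =
      ∫ h, E (fun k => (h k).1) ∂(π.historyLaw (⟨0, 0⟩ : BanditInstance d n) K) := by
    refine π.integral_eq_of_agree _ _ K E fun s hs k => ?_
    have hs' : ∀ k, s k ≠ j ∧ s k ≠ i := by
      by_contra hne
      exact hs (if_neg hne)
    simp [spiked, hs' k]
  -- Union bound: the probability of ever pulling an arm is at most its expected number of pulls.
  have h2 : 1 - π.expectedPulls (⟨0, 0⟩ : BanditInstance d n) K j -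
      π.expectedPulls (⟨0, 0⟩ : BanditInstance d n) K i ≤
      ∫ h, E (fun k => (h k).1) ∂(π.historyLaw (⟨0, 0⟩ : BanditInstance d n) K) := by
    have hj := π.integrable_arms (⟨0, 0⟩ : BanditInstance d n) K (N j)
    have hi := π.integrable_arms (⟨0, 0⟩ : BanditInstance d n) K (N i)
    have h3 : ∫ h, (1 - N j (fun k => (h k).1) - N i (fun k => (h k).1))
        ∂(π.historyLaw (⟨0, 0⟩ : BanditInstance d n) K) =
        1 - π.expectedPulls (⟨0, 0⟩ : BanditInstance d n) K j -
        π.expectedPulls (⟨0, 0⟩ : BanditInstance d n) K i := by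
      have hj' : Integrable (fun h : History n K => 1 - N j (fun k => (h k).1))
        (π.historyLaw (⟨0, 0⟩ : BanditInstance d n) K) := (integrable_const _).sub hj
      rw [integral_sub hj' hi, integral_sub (integrable_const _) hj]
      simp [N, expectedPulls]
    rw [← h3]
    refine integral_mono (((integrable_const _).sub hj).sub hi) (π.integrable_arms _ K E)
      fun h => ?_
    by_cases hE : ∀ k, (h k).1 ≠ j ∧ (h k).1 ≠ i
    · have hj0 := hN j fun k => (h k).1
      have hi0 := hN i fun k => (h k).1
      simp only [E, if_pos hE]
      linarith
    · have hj0 := hN j fun k => (h k).1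
      have hi0 := hN i fun k => (h k).1
      simp only [E, if_neg hE]
      push Not at hE
      obtain ⟨k, hk⟩ := hE
      by_cases hkj : (h k).1 = j
      · linarith [hN1 j (fun k => (h k).1) k hkj]
      · linarith [hN1 i (fun k => (h k).1) k (hk hkj)]
  refine (mul_le_mul_of_nonneg_left h2 (by positivity)).trans ?_
  rw [← h1, ← integral_const_mul]
  refine integral_mono ((π.integrable_arms _ K E).const_mul _)
    (π.integrable_arms _ K fun s => ∑ k, (spiked x Δ j i).gap (s k)) fun h => ?_
  by_cases hE : ∀ k, (h k).1 ≠ j ∧ (h k).1 ≠ i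
  · change _ ≤ ∑ k : Fin K, (spiked x Δ j i).gap (h k).1
    refine le_of_eq ?_
    simp [E, hE, gap_spiked x hΔ hij]
    ring
  · simp only [E, if_neg hE, mul_zero]
    exact Finset.sum_nonneg fun _ _ => gap_nonneg _ _

theorem le_sum_expectedRegret_spiked (hΔ : 0 < Δ) (K : ℕ) (hK : (8 : ℝ) * K ≤ n) (hn : 8 ≤ n) :
    (n : ℝ) ^ 2 * (K * Δ) ≤ ∑ p : Fin n × Fin n, π.expectedRegret (spiked x Δ p.1 p.2) K := by
  set q : Fin n → ℝ := π.expectedPulls (⟨0, 0⟩ : BanditInstance d n) K with hq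
  have hqsum : ∑ a, q a = K := π.sum_expectedPulls _ K
  have hq0 : ∀ a, 0 ≤ q a := π.expectedPulls_nonneg _ K
  -- On the diagonal only nonnegativity is used; the correction term makes the bound uniform in the
  -- pair.
  have h1 : ∀ p : Fin n × Fin n, 2 * Δ * K * (1 - q p.1 - q p.2) -
      (if p.2 = p.1 then 2 * Δ * K else 0) ≤ π.expectedRegret (spiked x Δ p.1 p.2) K := by
    rintro ⟨j, i⟩
    by_cases hij : i = j
    · simp only [if_pos hij]
      have h2 := π.expectedRegret_nonneg (spiked x Δ j i) K
      have h3 : 0 ≤ 2 * Δ * K * (q j + q i) :=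
        mul_nonneg (by positivity) (add_nonneg (hq0 j) (hq0 i))
      linarith
    · simp only [if_neg hij, sub_zero]
      exact π.le_expectedRegret_spiked x hΔ hij K
  refine le_trans ?_ (Finset.sum_le_sum fun p _ => h1 p)
  rw [Finset.sum_sub_distrib, ← Finset.mul_sum, Fintype.sum_prod_type, Fintype.sum_prod_type]
  simp only [Finset.sum_sub_distrib, Finset.sum_const, Finset.card_univ, Fintype.card_fin,
    hqsum, Finset.sum_ite_eq', Finset.mem_univ, if_true, nsmul_eq_mul, ← Finset.mul_sum, mul_one]
  have hn8 : (8 : ℝ) ≤ n := by exact_mod_cast hn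
  have hKΔ : 0 ≤ Δ * K := by positivity
  -- Summing `q p.1 + q p.2` over all pairs gives `2nK`, and the diagonal loses `n` terms; `8K ≤ n`
  -- and `8 ≤ n` make both losses affordable.
  have h4 : 0 ≤ (n : ℝ) ^ 2 - 4 * n * K - 2 * n := by nlinarith
  nlinarith [mul_nonneg hKΔ h4]

theorem integral_sq_spiked {j i : Fin n} (hij : i ≠ j) (K : ℕ) :
    ∫ h, ∑ k, ((spiked x Δ j i).mean (h k).1 - (spiked x Δ j j).mean (h k).1) ^ 2 / 2
      ∂(π.historyLaw (spiked x Δ j j) K) =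
      2 * Δ ^ 2 * π.expectedPulls (spiked x Δ j j) K i := by
  rw [π.integral_sum_arms _ K fun a =>
    ((spiked x Δ j i).mean a - (spiked x Δ j j).mean a) ^ 2 / 2, Finset.sum_eq_single i]
  · simp only [spiked, if_neg hij, if_true]
    ring
  · intro a _ ha
    by_cases haj : a = j <;> simp [spiked, ha, haj]
  · simp

/-- No arm is optimal in both instances, so each round costs at least `Δ` in total over the two, and
one of the two regrets is at least `KΔ / 2` along any arm sequence. -/
theorem exp_le_expectedRegret_add (hΔ : 0 < Δ) {j i : Fin n} (hij : i ≠ j) (K : ℕ) :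
    K * Δ / 4 * Real.exp (-(2 * Δ ^ 2 * π.expectedPulls (spiked x Δ j j) K i)) ≤
      π.expectedRegret (spiked x Δ j j) K + π.expectedRegret (spiked x Δ j i) K := by
  have h := π.half_mul_exp_le_integral_add_integral (spiked x Δ j j) (spiked x Δ j i) K
    (fun s => ∑ k, (spiked x Δ j j).gap (s k)) (fun s => ∑ k, (spiked x Δ j i).gap (s k))
    (fun s => Finset.sum_nonneg fun _ _ => gap_nonneg _ _)
    (fun s => Finset.sum_nonneg fun _ _ => gap_nonneg _ _) (c := K * Δ / 2) (by positivity)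
    fun s => ?_
  · rw [π.integral_sq_spiked x hij] at h
    refine le_trans (le_of_eq ?_) h
    ring
  · have h1 : K * Δ ≤ ∑ k, (spiked x Δ j j).gap (s k) + ∑ k, (spiked x Δ j i).gap (s k) := by
      rw [← Finset.sum_add_distrib]
      have h2 := Finset.card_nsmul_le_sum Finset.univ
        (fun k => (spiked x Δ j j).gap (s k) + (spiked x Δ j i).gap (s k)) Δ fun k _ => by
          rw [gap_spiked_self x hΔ, gap_spiked x hΔ hij]
          split_ifs <;> linarith
      simpa using h2
    by_contra hne
    push Not at hne
    linarith [hne.1, hne.2]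

/-- The regret of a spiked instance is logarithmic as soon as the regret of all neighbouring
instances is at most `B`. -/
theorem log_le_expectedRegret_spiked (hΔ : 0 < Δ) (hn : 2 ≤ n) (j : Fin n) {K : ℕ} (hK : 1 ≤ K)
    {B : ℝ} (hB : 0 < B) (hreg : ∀ i, π.expectedRegret (spiked x Δ j i) K ≤ B) :
    n / (4 * Δ) * Real.log (K * Δ / (8 * B)) ≤ π.expectedRegret (spiked x Δ j j) K := by
  have hKR : (1 : ℝ) ≤ K := by exact_mod_cast hK
  set N := π.expectedPulls (spiked x Δ j j) K with hN
  have hN0 : ∀ a, 0 ≤ N a := π.expectedPulls_nonneg _ K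
  have hregret : π.expectedRegret (spiked x Δ j j) K = Δ * ∑ a ∈ Finset.univ.erase j, N a := by
    rw [expectedRegret_eq_sum, ← Finset.add_sum_erase _ _ (Finset.mem_univ j), Finset.mul_sum,
      gap_spiked_self x hΔ, if_pos rfl, zero_mul, zero_add]
    refine Finset.sum_congr rfl fun a ha => ?_
    rw [gap_spiked_self x hΔ, if_neg (Finset.ne_of_mem_erase ha)]
  rcases le_or_gt (Real.log (K * Δ / (8 * B))) 0 with hl | hl
  · exact (mul_nonpos_of_nonneg_of_nonpos (by positivity) hl).trans
      (π.expectedRegret_nonneg _ K)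
  have hpull : ∀ i ∈ Finset.univ.erase j,
      -- Both regrets are at most `B`, so the exponential is at least `K * Δ / (8 * B)` after
      -- inversion; solve for `N i`.
      Real.log (K * Δ / (8 * B)) / (2 * Δ ^ 2) ≤ N i := fun i hi => by
    have h1 := π.exp_le_expectedRegret_add x hΔ (Finset.ne_of_mem_erase hi) K
    have h2 := hreg i
    have h3 := hreg j
    rw [div_le_iff₀ (by positivity), Real.log_le_iff_le_exp (by positivity),
      div_le_iff₀ (by positivity)]
    rw [← hN, Real.exp_neg, ← div_eq_mul_inv, div_le_iff₀ (Real.exp_pos _)] at h1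
    rw [show N i * (2 * Δ ^ 2) = 2 * Δ ^ 2 * N i by ring]
    nlinarith [Real.exp_pos (2 * Δ ^ 2 * N i)]
  have hsum := Finset.card_nsmul_le_sum _ _ _ hpull
  rw [Finset.card_erase_of_mem (Finset.mem_univ j), Finset.card_univ, Fintype.card_fin,
    nsmul_eq_mul, Nat.cast_sub (by omega)] at hsum
  rw [hregret]
  refine le_trans ?_ (mul_le_mul_of_nonneg_left hsum hΔ.le)
  have hn2 : (2 : ℝ) ≤ n := by exact_mod_cast hn
  -- There are `n - 1` arms besides `j`, and `2 * (n - 1) ≥ n`; this gives the constant `4`.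
  have h5 : Δ * (((n : ℝ) - (1 : ℕ)) * (Real.log (K * Δ / (8 * B)) / (2 * Δ ^ 2))) =
      (2 * (n - 1)) / (4 * Δ) * Real.log (K * Δ / (8 * B)) := by
    push_cast
    field_simp
    ring
  rw [h5]
  gcongr
  linarith

end BanditAlgorithm

/-! ### Calibration of constants and conclusion -/

/-- The bound `n * log K / (800 * Δ * log (n / Δ))` on the regret contradicts the logarithmic lower
bound that it implies. -/
theorem log_div_log_le {n K Δ : ℝ} (hn : 2 ≤ n) (hΔ : 0 < Δ) (hΔ1 : Δ ≤ 1)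
    (hK : n / Δ ^ 2 ≤ K) :
    1 / 800 * (n * Real.log K / Δ) / Real.log (n / Δ) ≤
      n / (4 * Δ) * Real.log (K * Δ /
        (8 * (1 / 800 * (n * Real.log K / Δ) / Real.log (n / Δ)))) := by
  have hΔ2 : Δ ^ 2 ≤ 1 := by nlinarith
  have hm : 2 ≤ n / Δ ^ 2 := by rw [le_div_iff₀ (by positivity)]; nlinarith
  have hnΔ : 2 ≤ n / Δ := by rw [le_div_iff₀ hΔ]; nlinarith
  have hK2 : 2 ≤ K := hm.trans hK
  set L := Real.log (n / Δ) with hL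
  have hlog2 : 0.6931471803 < Real.log 2 := Real.log_two_gt_d9
  have hL2 : Real.log 2 ≤ L := Real.log_le_log (by norm_num) hnΔ
  have hLpos : 0 < L := by linarith
  set ℓ := Real.log K with hℓ
  have hℓpos : 0 < ℓ := Real.log_pos (by linarith)
  set t := K * Δ ^ 2 / n with ht
  have ht1 : 1 ≤ t := by
    rw [ht, le_div_iff₀ (by linarith), one_mul]
    rwa [div_le_iff₀ (by positivity)] at hK
  set τ := Real.log t with hτ
  have hτ0 : 0 ≤ τ := Real.log_nonneg ht1
  have hℓle : ℓ ≤ τ + 2 * L := by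
    have h1 : K ≤ t * (n / Δ) ^ 2 := by
      have : t * (n / Δ) ^ 2 = K * n := by rw [ht]; field_simp
      rw [this]
      nlinarith
    have h2 := Real.log_le_log (by linarith) h1
    rwa [Real.log_mul (by linarith) (by positivity), Real.log_pow] at h2
  set u := ℓ / L with hu
  have hupos : 0 < u := div_pos hℓpos hLpos
  -- Divide `ℓ ≤ τ + 2 * L` by `L ≥ log 2 > 1 / 2`.
  have hule : u ≤ 2 * τ + 2 := by
    rw [hu, div_le_iff₀ hLpos]
    nlinarith
  have harg : K * Δ / (8 * (1 / 800 * (n * ℓ / Δ) / L)) = 100 * (t / u) := by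
    rw [ht, hu]
    field_simp
    norm_num
  have hlhs : 1 / 800 * (n * ℓ / Δ) / L = n / (4 * Δ) * (u / 200) := by
    rw [hu]
    field_simp
    norm_num
  rw [harg, hlhs]
  -- It remains to see `u / 200 ≤ log 100 + τ - log u`. With `τ ≥ u / 2 - 1` and `log u ≤ u / 4 +
  -- 1`, the right side is at least `2 + u / 4`.
  refine mul_le_mul_of_nonneg_left ?_ (by positivity)
  have hlog100 : 4 ≤ Real.log 100 := by
    rw [Real.le_log_iff_exp_le (by norm_num)]
    have := Real.exp_one_lt_d9
    calc Real.exp 4 = Real.exp 1 ^ 4 := by rw [← Real.exp_nat_mul]; norm_num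
      _ ≤ 2.7182818286 ^ 4 := by gcongr
      _ ≤ 100 := by norm_num
  have hlogu : Real.log u ≤ u / 4 + 1 := by
    have h1 := Real.log_le_sub_one_of_pos (by positivity : 0 < u / 4)
    rw [Real.log_div hupos.ne' (by norm_num)] at h1
    have h2 : Real.log 4 ≤ 2 := by
      rw [show (4 : ℝ) = 2 ^ 2 by norm_num, Real.log_pow]
      have := Real.log_two_lt_d9
      push_cast
      linarith
    linarith
  rw [Real.log_mul (by norm_num) (by positivity), Real.log_div (by linarith) hupos.ne']
  linarith

theorem theorem3 :
    ∃ c₀ : ℝ, 0 < c₀ ∧ ∃ c₁ : ℝ, 0 < c₁ ∧ ∃ c₂ : ℝ, 0 < c₂ ∧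
      ∀ (d n : ℕ), 2 ≤ d → 2 ≤ n →
      ∀ (Δ ζ : ℝ), 0 < Δ → Δ ≤ 1 →
        3 * Δ * Real.sqrt (8 * Real.log (n : ℝ) / ((d : ℝ) - 1)) ≤ ζ →
      ∃ (x : Fin n ↪ EuclideanSpace ℝ (Fin d)) (Θ : Finset (BanditInstance d n)),
        Θ.Nonempty ∧
        (∀ a, ‖x a‖ = 1) ∧
        (∀ ν ∈ Θ, ‖ν.param‖ ≤ 3 * Δ ∧ (∀ a, 0 ≤ ν.mean a ∧ ν.mean a ≤ 2 * Δ) ∧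
          ν.HasMinGap Δ ∧ ν.IsMisspecified x ζ) ∧
        ∀ (π : BanditAlgorithm n) (K : ℕ) (C α : ℝ), 1 ≤ K → 0 < C → 0 ≤ α → α < 1 →
          (∀ ν ∈ Θ, π.expectedRegret ν K ≤ C * (K : ℝ) ^ α) →
          -- linear average regret when `K ≤ O(n)`
          ((K : ℝ) ≤ c₀ * n →
            (K : ℝ) * Δ ≤ (∑ ν ∈ Θ, π.expectedRegret ν K) / (Θ.card : ℝ)) ∧
          -- logarithmic worst-case regret when `K ≥ Ω(n)`, up to a factor `log (n / Δ)`
          (c₁ * n / Δ ^ 2 ≤ (K : ℝ) →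
            c₂ * ((n : ℝ) * Real.log K / Δ) / Real.log ((n : ℝ) / Δ) ≤
              ⨆ ν : {ν // ν ∈ Θ}, π.expectedRegret ν.1 K) ∧
          -- logarithmic worst-case regret in terms of the assumed bound `C * K ^ α`
          c₂ * (n : ℝ) / Δ *
              max ((1 - α) * Real.log K - Real.log (8 * C / Δ)) 0 ≤
            ⨆ ν : {ν // ν ∈ Θ}, π.expectedRegret ν.1 K := by
  refine ⟨1 / 8, by norm_num, 1, one_pos, 1 / 800, by norm_num, ?_⟩
  intro d n hd hn Δ ζ hΔ hΔ1 hζ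
  obtain ⟨x, hx, hxε⟩ := exists_nearly_orthogonal_unit_vectors hd hn
  have hn2 : (2 : ℝ) ≤ n := by exact_mod_cast hn
  let j₀ : Fin n := ⟨0, by omega⟩
  let Θ : Finset (BanditInstance d n) := Finset.univ.map
    ⟨fun p : Fin n × Fin n => BanditInstance.spiked x Δ p.1 p.2,
      BanditInstance.spiked_injective x hΔ⟩
  have hmem : ∀ j i, BanditInstance.spiked x Δ j i ∈ Θ := fun j i =>
    Finset.mem_map.2 ⟨(j, i), Finset.mem_univ _, rfl⟩
  refine ⟨x, Θ, ⟨_, hmem j₀ j₀⟩, hx, ?_, ?_⟩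
  · intro ν hν
    obtain ⟨⟨j, i⟩, -, rfl⟩ := Finset.mem_map.1 hν
    exact ⟨BanditInstance.norm_param_spiked_le x hΔ hx j i,
      BanditInstance.mean_spiked_mem x hΔ j i, BanditInstance.hasMinGap_spiked x hΔ hn j i,
      BanditInstance.isMisspecified_spiked x hΔ hx (Real.sqrt_nonneg _) hxε hζ j i⟩
  intro π K C α hK hC _ _ hreg
  have hK1 : (1 : ℝ) ≤ K := by exact_mod_cast hK
  set R := ⨆ ν : {ν // ν ∈ Θ}, π.expectedRegret ν.1 K with hR
  have hle : ∀ j i, π.expectedRegret (BanditInstance.spiked x Δ j i) K ≤ R := fun j i =>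
    le_ciSup (f := fun ν : {ν // ν ∈ Θ} => π.expectedRegret ν.1 K)
      (Set.finite_range _).bddAbove ⟨_, hmem j i⟩
  have hR0 : 0 ≤ R := (π.expectedRegret_nonneg _ K).trans (hle j₀ j₀)
  refine ⟨fun hKn => ?_, fun hKn => ?_, ?_⟩
  · have hn8 : (8 : ℝ) ≤ n := by linarith
    have h1 := π.le_sum_expectedRegret_spiked x hΔ K (by linarith) (by exact_mod_cast hn8)
    simp only [Θ, Finset.sum_map, Finset.card_map, Function.Embedding.coeFn_mk, Finset.card_univ,
      Fintype.card_prod, Fintype.card_fin]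
    rw [le_div_iff₀ (by push_cast; positivity)]
    push_cast
    linarith
  · rw [one_mul] at hKn
    have h1 := log_div_log_le hn2 hΔ hΔ1 hKn
    -- If the supremum were below the claimed value, that value could serve as `B`, and the
    -- resulting lower bound would be at least the same value.
    by_contra hlt
    push Not at hlt
    have h2 := π.log_le_expectedRegret_spiked x hΔ hn j₀ hK (hR0.trans_lt hlt)
      fun i => (hle j₀ i).trans hlt.le
    linarith [hle j₀ j₀]
  · have hKα : (0 : ℝ) < (K : ℝ) ^ α := Real.rpow_pos_of_pos (by linarith) _
    have h1 := π.log_le_expectedRegret_spiked x hΔ hn j₀ hK (mul_pos hC hKα)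
      fun i => hreg _ (hmem j₀ i)
    have h2 : Real.log (K * Δ / (8 * (C * (K : ℝ) ^ α))) =
        (1 - α) * Real.log K - Real.log (8 * C / Δ) := by
      have h3 : (K : ℝ) * Δ / (8 * (C * (K : ℝ) ^ α)) = K / K ^ α / (8 * C / Δ) := by
        field_simp
      rw [h3, Real.log_div (by positivity) (by positivity),
        Real.log_div (by positivity) (by positivity), Real.log_rpow (by linarith)]
      ring
    rw [h2] at h1
    rcases le_total ((1 - α) * Real.log K - Real.log (8 * C / Δ)) 0 with h4 | h4
    · rw [max_eq_right h4, mul_zero]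
      exact hR0
    · rw [max_eq_left h4]
      refine le_trans ?_ (h1.trans (hle j₀ j₀))
      refine mul_le_mul_of_nonneg_right ?_ h4
      rw [div_le_div_iff₀ hΔ (by positivity)]
      nlinarith
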